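/- A circular ordering on a group $G$ is a function $c\colon G^3\to\{0,\pm1\}$ such that (i) $c(g_1,g_2,g_3)=0$ if and only if $g_i=g_j$ for some $i\neq j$; (ii) $c(g_2,g_3,g_4)-c(g_1,g_3,g_4)+c(g_1,g_2,g_4)-c(g_1,g_2,g_3)=0$ for all $g_1,g_2,g_3,g_4\in G$; and (iii) $c(hg_1,hg_2,hg_3)=c(g_1,g_2,g_3)$ for all $h,g_1,g_2,g_3\in G$. It is bi-invariant if moreover $c(g_1h,g_2h,g_3h)=c(g_1,g_2,g_3)$ for all $h,g_1,g_2,g_3\in G$. A group is circularly-orderable if it admits a circular ordering, and left-orderable if it admits a strict total ordering invariant under left multiplication. For a group $G$ let $$\operatorname{Ob}(G)=\{n\in\mathbb{N}_{\geq 2}\mid G\times\mathbb{Z}/n\mathbb{Z}\text{ is not circularly-orderable}\},$$ partially ordered by divisibility, and let $\min(\operatorname{Ob}(G))$ be its set of minimal elements. (1) Let $G$ and $H$ be groups each admitting a bi-invariant circular ordering. Then $G\times H$ is circularly-orderable if and only if $\min(\operatorname{Ob}(G))\cap\min(\operatorname{Ob}(H))=\emptyset$. (2) Let $G$ be a group admitting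 a bi-invariant circular ordering. Then $G\times G$ is circularly-orderable if and only if $G$ is left-orderable. -/

import Mathlib

/-- A circular ordering on a group `G`: a function `c : G³ → {0, ±1} ⊆ ℤ` that vanishes exactly on
the triples with a repeated entry, satisfies the (homogeneous) cocycle condition, and is invariant
under left multiplication. -/
structure IsCircularOrdering {G : Type*} [Group G] (c : G → G → G → ℤ) : Prop where
  values : ∀ g₁ g₂ g₃ : G, c g₁ g₂ g₃ = 0 ∨ c g₁ g₂ g₃ = 1 ∨ c g₁ g₂ g₃ = -1
  eq_zero_iff : ∀ g₁ g₂ g₃ : G, c g₁ g₂ g₃ = 0 ↔ (g₁ = g₂ ∨ g₁ = g₃ ∨ g₂ = g₃)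
  cocycle : ∀ g₁ g₂ g₃ g₄ : G,
    c g₂ g₃ g₄ - c g₁ g₃ g₄ + c g₁ g₂ g₄ - c g₁ g₂ g₃ = 0
  left_invariant : ∀ h g₁ g₂ g₃ : G, c (h * g₁) (h * g₂) (h * g₃) = c g₁ g₂ g₃

/-- A bi-invariant circular ordering: one that is also invariant under right multiplication. -/
structure IsBiInvariantCircularOrdering {G : Type*} [Group G] (c : G → G → G → ℤ) : Prop
    extends IsCircularOrdering c where
  right_invariant : ∀ h g₁ g₂ g₃ : G, c (g₁ * h) (g₂ * h) (g₃ * h) = c g₁ g₂ g₃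

/-- `G` is circularly-orderable. -/
def CircularlyOrderable (G : Type*) [Group G] : Prop :=
  ∃ c : G → G → G → ℤ, IsCircularOrdering c

/-- `G` admits a bi-invariant circular ordering. -/
def BiInvariantlyCircularlyOrderable (G : Type*) [Group G] : Prop :=
  ∃ c : G → G → G → ℤ, IsBiInvariantCircularOrdering c

/-- `G` is left-orderable: it admits a strict total order invariant under left multiplication. -/
def LeftOrderable (G : Type*) [Group G] : Prop :=
  ∃ lt : G → G → Prop, IsStrictTotalOrder G lt ∧
    ∀ h g₁ g₂ : G, lt g₁ g₂ → lt (h * g₁) (h * g₂)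

/-- The obstruction spectrum: the `n ≥ 2` for which `G × ℤ/nℤ` is not circularly-orderable. -/
def obstructionSpectrum (G : Type*) [Group G] : Set ℕ :=
  {n | 2 ≤ n ∧ ¬ CircularlyOrderable (G × Multiplicative (ZMod n))}

/-- The minimal elements of the obstruction spectrum, partially ordered by divisibility. -/
def minObstructionSpectrum (G : Type*) [Group G] : Set ℕ :=
  {n | n ∈ obstructionSpectrum G ∧ ∀ m ∈ obstructionSpectrum G, m ∣ n → m = n}

/-!
Both equivalences reduce to torsion. Call a prime `p` a torsion prime of `G` if `G` has an element
of order `p`. For bi-invariantly circularly-ordered groups, `G × H` is circularly-orderable if and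
only if `G` and `H` have no torsion prime in common (`circularlyOrderable_prod_iff`). Applied with
`H = ℤ/nℤ`, this says that `n ≥ 2` is an obstruction for `G` exactly when some torsion prime of `G`
divides `n`, so the minimal obstructions are the torsion primes. Moreover `G` is left-orderable if
and only if it has no torsion primes (`leftOrderable_iff_torsionPrimes_eq_empty`).

A common torsion prime is an obstruction because finite circularly-ordered groups are cyclic
(`IsCircularOrdering.isCyclic_of_finite`). The other direction rests on two consequences of
bi-invariance:

* Conjugation fixes `1`, so it preserves the linear order obtained by cutting the circle at `1`.
  Hence `G` maps to the automorphism group of a totally ordered set, which is left-orderable, and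
  the kernel is the centre. A torsion-free group with abelian kernel over a left-orderable group is
  left-orderable, since torsion-free abelian groups are.
* The rotation number is a homomorphism `G → ℝ/ℤ`, injective on torsion elements
  (`IsBiInvariantCircularOrdering.exists_rotationNumber`). It comes from the central extension of
  `G` by `ℤ` defined by the Euler cocycle; this extension is bi-ordered, so that translation numbers
  are additive on it, as in the proof of Hölder's theorem.

If `G` and `H` have no common torsion prime, the sum of the two rotation numbers is a homomorphism
`G × H → ℝ/ℤ` with torsion-free kernel. By the first point this kernel is left-orderable, and a
lexicographic construction (`circularlyOrderable_of_leftOrderable_ker`) then gives a circular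
ordering of `G × H`.
-/

/-! ### Positive cones and left-orderability -/

/-- The data of a left-ordering, as its set of elements greater than the identity: a subsemigroup
which contains exactly one of `g`, `g⁻¹` for each `g ≠ 1`. -/
structure IsPositiveCone {G : Type*} [Group G] (P : Set G) : Prop where
  one_notMem : (1 : G) ∉ P
  mul_mem : ∀ {a b : G}, a ∈ P → b ∈ P → a * b ∈ P
  mem_or_inv_mem : ∀ {a : G}, a ≠ 1 → a ∈ P ∨ a⁻¹ ∈ P

lemma leftOrderable_iff_exists_isPositiveCone {G : Type*} [Group G] :
    LeftOrderable G ↔ ∃ P : Set G, IsPositiveCone P := by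
  constructor
  · rintro ⟨lt, hlt, hinv⟩
    refine ⟨{g | lt 1 g}, irrefl_of lt 1, fun {a b} ha hb ↦ ?_, fun {a} ha ↦ ?_⟩
    · have := hinv a 1 b hb
      rw [mul_one] at this
      exact trans_of lt ha this
    · rcases trichotomous_of lt 1 a with h | h | h
      · exact Or.inl h
      · exact absurd h.symm ha
      · right
        simpa using hinv a⁻¹ a 1 h
  · rintro ⟨P, hP⟩
    refine ⟨fun a b ↦ a⁻¹ * b ∈ P,
      { trichotomous := fun a b hab hba ↦ ?_, irrefl := fun a ↦ ?_, trans := fun a b d h h' ↦ ?_ },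
      fun h a b hab ↦ ?_⟩
    · by_contra hne
      have hne' : a⁻¹ * b ≠ 1 := fun h ↦ hne (inv_mul_eq_one.mp h)
      rcases hP.mem_or_inv_mem hne' with h | h
      · exact hab h
      · exact hba (by simpa using h)
    · simpa using hP.one_notMem
    · simpa [mul_assoc] using hP.mul_mem h h'
    · simpa [mul_assoc] using hab

lemma LeftOrderable.of_injective {G H : Type*} [Group G] [Group H] (f : G →* H)
    (hf : Function.Injective f) (hH : LeftOrderable H) : LeftOrderable G := by
  rw [leftOrderable_iff_exists_isPositiveCone] at hH ⊢
  obtain ⟨P, hP⟩ := hH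
  refine ⟨f ⁻¹' P, by simpa using hP.one_notMem, fun {a b} ha hb ↦ ?_, fun {a} ha ↦ ?_⟩
  · simpa using hP.mul_mem ha hb
  · simpa using hP.mem_or_inv_mem (a := f a) ((map_ne_one_iff f hf).mpr ha)

/-- An extension of a left-orderable group by a left-orderable group is left-orderable. -/
lemma LeftOrderable.of_ker {G H : Type*} [Group G] [Group H] (f : G →* H)
    (hH : LeftOrderable H) (hK : LeftOrderable f.ker) : LeftOrderable G := by
  rw [leftOrderable_iff_exists_isPositiveCone] at hH hK ⊢
  obtain ⟨P, hP⟩ := hH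
  obtain ⟨Q, hQ⟩ := hK
  refine ⟨{g | f g ∈ P ∨ ∃ k ∈ Q, (k : G) = g}, ?_, fun {a b} ha hb ↦ ?_, fun {a} ha ↦ ?_⟩
  · rintro (h | ⟨k, hk, h⟩)
    · exact hP.one_notMem (by simpa using h)
    · have : k = 1 := Subtype.ext h
      exact hQ.one_notMem (this ▸ hk)
  · rcases ha with ha | ⟨k, hk, rfl⟩ <;> rcases hb with hb | ⟨l, hl, rfl⟩
    · left; simpa using hP.mul_mem ha hb
    · left; rw [map_mul, l.2, mul_one]; exact ha
    · left; rw [map_mul, k.2, one_mul]; exact hb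
    · exact Or.inr ⟨k * l, hQ.mul_mem hk hl, rfl⟩
  · by_cases hfa : f a = 1
    · have : (⟨a, hfa⟩ : f.ker) ≠ 1 := fun h ↦ ha (congrArg Subtype.val h)
      rcases hQ.mem_or_inv_mem this with h | h
      · exact Or.inl (Or.inr ⟨_, h, rfl⟩)
      · exact Or.inr (Or.inr ⟨_, h, rfl⟩)
    · rcases hP.mem_or_inv_mem hfa with h | h
      · exact Or.inl (Or.inl h)
      · exact Or.inr (Or.inl (by simpa using h))

lemma LeftOrderable.prod {G H : Type*} [Group G] [Group H] (hG : LeftOrderable G)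
    (hH : LeftOrderable H) : LeftOrderable (G × H) := by
  refine .of_ker (MonoidHom.fst G H) hG
    (.of_injective ((MonoidHom.snd G H).comp (Subgroup.subtype _)) ?_ hH)
  rintro ⟨⟨a, b⟩, hab⟩ ⟨⟨a', b'⟩, hab'⟩ h
  rw [MonoidHom.mem_ker] at hab hab'
  simp_all

/-- A left-orderable group is torsion-free. -/
lemma LeftOrderable.eq_one_of_isOfFinOrder {G : Type*} [Group G] (hG : LeftOrderable G) {g : G}
    (hg : IsOfFinOrder g) : g = 1 := by
  obtain ⟨P, hP⟩ := leftOrderable_iff_exists_isPositiveCone.mp hG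
  by_contra hne
  have key : ∀ a ∈ P, ¬ IsOfFinOrder a := by
    intro a ha hfin
    obtain ⟨n, hn, hn1⟩ := isOfFinOrder_iff_pow_eq_one.mp hfin
    have : ∀ m : ℕ, a ^ (m + 1) ∈ P := by
      intro m
      induction m with
      | zero => simpa using ha
      | succ m ih => rw [pow_succ]; exact hP.mul_mem ih ha
    obtain ⟨m, rfl⟩ := Nat.exists_eq_succ_of_ne_zero hn.ne'
    exact hP.one_notMem (hn1 ▸ this m)
  rcases hP.mem_or_inv_mem hne with h | h
  · exact key _ h hg
  · exact key _ h hg.inv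

/-- The automorphism group of a totally ordered set is left-orderable: two automorphisms are
compared at the first point, for some well-ordering of the set, where they differ. -/
lemma leftOrderable_relIso {X : Type*} (r : X → X → Prop) [IsStrictTotalOrder X r] :
    LeftOrderable (r ≃r r) := by
  let L : (X → X) → (X → X) → Prop := Pi.Lex WellOrderingRel (fun {_} ↦ r)
  have htri : Std.Trichotomous L := Pi.trichotomous_lex _ _ WellOrderingRel.isWellOrder.wf
  refine ⟨fun σ τ ↦ L σ τ, { trichotomous := ?_, irrefl := ?_, trans := ?_ }, ?_⟩
  · intro σ τ h h'
    exact DFunLike.coe_injective (htri.trichotomous _ _ h h')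
  · rintro σ ⟨i, -, hi⟩
    exact irrefl_of r _ hi
  · rintro σ τ υ ⟨i, hi, hi'⟩ ⟨j, hj, hj'⟩
    rcases trichotomous_of WellOrderingRel i j with h | rfl | h
    · exact ⟨i, fun k hk ↦ (hi k hk).trans (hj k (trans_of WellOrderingRel hk h)), hj i h ▸ hi'⟩
    · exact ⟨i, fun k hk ↦ (hi k hk).trans (hj k hk), trans_of r hi' hj'⟩
    · exact ⟨j, fun k hk ↦ (hi k (trans_of WellOrderingRel hk h)).trans (hj k hk),
        (hi j h).symm ▸ hj'⟩
  · rintro υ σ τ ⟨i, hi, hi'⟩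
    exact ⟨i, fun k hk ↦ congrArg υ (hi k hk), υ.map_rel_iff.mpr hi'⟩

/-- Torsion-free abelian groups are left-orderable: they embed in a `ℚ`-vector space, which is
ordered lexicographically with respect to a basis. -/
lemma leftOrderable_of_commute {A : Type*} [Group A] (hcomm : ∀ a b : A, a * b = b * a)
    (htf : ∀ a : A, IsOfFinOrder a → a = 1) : LeftOrderable A := by
  let _ : CommGroup A := { ‹Group A› with mul_comm := hcomm }
  have : IsMulTorsionFree A := by
    refine ⟨fun n hn a b hab ↦ ?_⟩
    have h1 : (a / b) ^ n = 1 := by rw [div_pow]; exact div_eq_one.mpr hab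
    exact div_eq_one.mp
      (htf _ (isOfFinOrder_iff_pow_eq_one.mpr ⟨n, Nat.pos_of_ne_zero hn, h1⟩))
  let V := DivisibleHull (Additive A)
  let ι := Module.Basis.ofVectorSpaceIndex ℚ V
  let _ : LinearOrder ι := WellOrderingRel.isWellOrder.linearOrder
  let f : Additive A →+ (ι →₀ ℚ) :=
    ((Module.Basis.ofVectorSpace ℚ V).repr : V →+ (ι →₀ ℚ)).comp
      (DivisibleHull.coeAddMonoidHom (Additive A))
  have hf : Function.Injective f :=
    (Module.Basis.ofVectorSpace ℚ V).repr.injective.comp DivisibleHull.coe_injective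
  rw [leftOrderable_iff_exists_isPositiveCone]
  refine ⟨{a | 0 < toLex (f (.ofMul a))}, by simp, fun {a b} ha hb ↦ ?_, fun {a} ha ↦ ?_⟩
  · simpa using add_pos ha hb
  · have : toLex (f (.ofMul a)) ≠ 0 := fun h ↦ ha ((map_eq_zero_iff f hf).mp h)
    rcases this.lt_or_gt with h | h
    · right; simpa using h
    · exact Or.inl h

/-! ### Circular orderings -/

namespace IsCircularOrdering

variable {G : Type*} [Group G] {c : G → G → G → ℤ}

lemma rotate (hc : IsCircularOrdering c) (x y z : G) : c y z x = c x y z := by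
  have h1 := hc.cocycle x y z x
  have h2 := (hc.eq_zero_iff x z x).mpr (by simp)
  have h3 := (hc.eq_zero_iff x y x).mpr (by simp)
  lia

lemma swap (hc : IsCircularOrdering c) (x y z : G) : c x z y = -c x y z := by
  have h1 := hc.cocycle x y z y
  have h2 := (hc.eq_zero_iff y z y).mpr (by simp)
  have h3 := (hc.eq_zero_iff x y y).mpr (by simp)
  lia

lemma left_invariant' (hc : IsCircularOrdering c) (h x y z : G) :
    c x y z = c (h * x) (h * y) (h * z) := (hc.left_invariant h x y z).symm

lemma comp (hc : IsCircularOrdering c) {H : Type*} [Group H] (f : H →* G)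
    (hf : Function.Injective f) : IsCircularOrdering fun x y z ↦ c (f x) (f y) (f z) where
  values _ _ _ := hc.values _ _ _
  eq_zero_iff x y z := by simp [hc.eq_zero_iff, hf.eq_iff]
  cocycle _ _ _ _ := hc.cocycle _ _ _ _
  left_invariant h x y z := by simpa using hc.left_invariant _ _ _ _

/-- The linear order on `G`, with least element `1`, obtained by cutting the circle at `1`. -/
def cutLT (c : G → G → G → ℤ) (x y : G) : Prop := c 1 x y = 1 ∨ (x = 1 ∧ y ≠ 1)

lemma isStrictTotalOrder_cutLT (hc : IsCircularOrdering c) :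
    IsStrictTotalOrder G (cutLT c) where
  trichotomous x y hxy hyx := by
    simp only [cutLT, not_or, not_and, not_not] at hxy hyx
    have h1 := hc.values 1 x y
    have h2 := hc.swap 1 x y
    have h3 : c 1 x y = 0 := by lia
    rcases (hc.eq_zero_iff 1 x y).mp h3 with h | h | h
    · subst h; exact (hxy.2 rfl).symm
    · subst h; exact hyx.2 rfl
    · exact h
  irrefl x := by
    have := (hc.eq_zero_iff 1 x x).mpr (by simp)
    simp [cutLT, this]
  trans x y z hxy hyz := by
    rcases hxy with hxy | ⟨rfl, hy⟩
    · rcases hyz with hyz | ⟨rfl, -⟩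
      · left
        have h1 := hc.cocycle 1 x y z
        have h2 := hc.values x y z
        have h3 := hc.values 1 x z
        have h4 : c x y z ≠ -1 := by lia
        have h5 := (hc.eq_zero_iff x y z)
        have h6 := (hc.eq_zero_iff 1 x y)
        have h7 := (hc.eq_zero_iff 1 y z)
        lia
      · have := (hc.eq_zero_iff 1 x 1).mpr (by simp)
        lia
    · right
      refine ⟨rfl, ?_⟩
      rintro rfl
      rcases hyz with h | h
      · have := (hc.eq_zero_iff 1 y 1).mpr (by simp)
        lia
      · exact h.2 rfl

/-- A finite circularly-ordered group is cyclic: it is generated by the successor of `1`. -/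
lemma isCyclic_of_finite [Finite G] (hc : IsCircularOrdering c) : IsCyclic G := by
  have hlt := hc.isStrictTotalOrder_cutLT
  have hwf : WellFounded (cutLT c) := Finite.wellFounded_of_trans_of_irrefl _
  by_cases hnt : ∃ g : G, g ≠ 1
  swap
  · push Not at hnt
    exact ⟨1, fun g ↦ by simp [hnt g]⟩
  let m := hwf.min {g | g ≠ 1} hnt
  have hm1 : m ≠ 1 := hwf.min_mem {g | g ≠ 1} hnt
  -- No element lies strictly between `1` and `m`.
  have hmin : ∀ g, c 1 g m ≠ 1 := by
    intro g hg
    refine hwf.not_lt_min {g | g ≠ 1} (x := g) ?_ (Or.inl hg)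
    rintro rfl
    have := (hc.eq_zero_iff 1 1 m).mpr (by simp)
    lia
  refine ⟨m, fun x ↦ ?_⟩
  by_contra hx
  -- The least element `h` of `x⟨m⟩` exceeds `h * m⁻¹`, because `m⁻¹` is the greatest element.
  have hne : {g : G | x⁻¹ * g ∈ Subgroup.zpowers m}.Nonempty := ⟨x, by simp⟩
  let h := hwf.min _ hne
  have hh : x⁻¹ * h ∈ Subgroup.zpowers m := hwf.min_mem _ hne
  have hhm : h ∉ Subgroup.zpowers m := fun h' ↦ hx <| Subgroup.mem_zpowers_iff.mp <| by
    simpa using Subgroup.mul_mem _ h' (Subgroup.inv_mem _ hh)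
  have hlt' : ¬ cutLT c (h * m⁻¹) h := by
    refine hwf.not_lt_min _ (x := h * m⁻¹) ?_
    simpa [← mul_assoc] using
      Subgroup.mul_mem _ hh (Subgroup.inv_mem _ (Subgroup.mem_zpowers m))
  have e1 : c 1 (h * m⁻¹) h = c 1 h⁻¹ m⁻¹ := by
    rw [hc.left_invariant' h⁻¹, ← hc.rotate 1 h⁻¹ m⁻¹]
    simp
  have e2 : c 1 h⁻¹ m⁻¹ = c 1 m (m * h⁻¹) := by
    rw [hc.left_invariant' m, ← hc.rotate, ← hc.rotate]
    simp
  have e3 := hc.swap 1 m (m * h⁻¹)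
  have h1 := hmin (m * h⁻¹)
  have h2 := hc.values 1 m (m * h⁻¹)
  have h3 : c 1 m (m * h⁻¹) ≠ 1 := fun h' ↦ hlt' (Or.inl (by lia))
  have h4 : c 1 m (m * h⁻¹) = 0 := by lia
  rcases (hc.eq_zero_iff _ _ _).mp h4 with h5 | h5 | h5
  · exact hm1 h5.symm
  · refine hhm ?_
    rw [← mul_inv_eq_one.mp h5.symm]; exact Subgroup.mem_zpowers m
  · refine hhm ?_
    rw [left_eq_mul, inv_eq_one] at h5
    rw [h5]; exact Subgroup.one_mem _

end IsCircularOrdering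

lemma CircularlyOrderable.of_injective {G H : Type*} [Group G] [Group H] (f : G →* H)
    (hf : Function.Injective f) (hH : CircularlyOrderable H) : CircularlyOrderable G := by
  obtain ⟨c, hc⟩ := hH
  exact ⟨_, hc.comp f hf⟩

/-- Elements of the same prime order in the two factors generate a non-cyclic finite subgroup. -/
lemma CircularlyOrderable.orderOf_ne_of_prod {G H : Type*} [Group G] [Group H]
    (h : CircularlyOrderable (G × H)) {p : ℕ} (hp : p.Prime) {x : G} {y : H}
    (hx : orderOf x = p) (hy : orderOf y = p) : False := by
  let K := Subgroup.zpowers x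
  let L := Subgroup.zpowers y
  have hK : Nat.card K = p := by rw [Nat.card_zpowers, hx]
  have hL : Nat.card L = p := by rw [Nat.card_zpowers, hy]
  have : Finite K := Nat.finite_of_card_ne_zero (by rw [hK]; exact hp.ne_zero)
  have : Finite L := Nat.finite_of_card_ne_zero (by rw [hL]; exact hp.ne_zero)
  obtain ⟨c, hc⟩ := h.of_injective (K.subtype.prodMap L.subtype)
    (Function.Injective.prodMap K.subtype_injective L.subtype_injective)
  obtain ⟨g, hg⟩ := hc.isCyclic_of_finite
  have h1 : orderOf g = p * p := by
    rw [orderOf_eq_card_of_forall_mem_zpowers hg, Nat.card_prod, hK, hL]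
  have h2 : orderOf g ∣ p := by
    rw [orderOf_dvd_iff_pow_eq_one]
    refine Prod.ext ?_ ?_
    · rw [Prod.pow_fst, ← hK, pow_card_eq_one']; rfl
    · rw [Prod.pow_snd, ← hL, pow_card_eq_one']; rfl
  rw [h1] at h2
  have := Nat.le_of_dvd hp.pos h2
  have := hp.two_le
  nlinarith

/-- A group is circularly-orderable as soon as it has a homomorphism to `ℝ/ℤ` with left-orderable
kernel. The circular ordering is lexicographic. It is written as the coboundary of
`s x y = r (x⁻¹ * y)`, where `r g` is the representative of `φ g` in `[0, 1)`, rescaled to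
`[-1, 1)`, if `φ g ≠ 0`, and the sign of `g` if `φ g = 0`; this makes invariance and the cocycle
condition automatic. -/
lemma circularlyOrderable_of_leftOrderable_ker {G : Type*} [Group G]
    (φ : G →* Multiplicative UnitAddCircle) (hφ : LeftOrderable φ.ker) :
    CircularlyOrderable G := by
  classical
  obtain ⟨Q, hQ⟩ := leftOrderable_iff_exists_isPositiveCone.mp hφ
  -- The positive cone of the kernel, as a subset of `G`.
  obtain ⟨P, hP1, hPmul, hPtot⟩ : ∃ P : Set G, (1 ∉ P) ∧ (∀ a b, a ∈ P → b ∈ P → a * b ∈ P) ∧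
      (∀ a, φ a = 1 → a ≠ 1 → a ∈ P ∨ a⁻¹ ∈ P) := by
    refine ⟨Subtype.val '' Q, ?_, ?_, ?_⟩
    · rintro ⟨k, hk, hk1⟩
      have : k = 1 := Subtype.ext hk1
      exact hQ.one_notMem (this ▸ hk)
    · rintro _ _ ⟨k, hk, rfl⟩ ⟨l, hl, rfl⟩
      exact ⟨k * l, hQ.mul_mem hk hl, rfl⟩
    · intro a ha ha1
      rcases hQ.mem_or_inv_mem (a := ⟨a, ha⟩) (fun h ↦ ha1 (congrArg Subtype.val h)) with h | h
      · exact Or.inl ⟨_, h, rfl⟩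
      · exact Or.inr ⟨_, h, rfl⟩
  have hPinv : ∀ a, a ∈ P → a⁻¹ ∉ P := fun a ha ha' ↦ hP1 (by simpa using hPmul _ _ ha ha')
  -- The representative in `[0, 1)`.
  obtain ⟨θ, hθ, hθmem⟩ : ∃ θ : G → ℝ, (∀ g, ((θ g : ℝ) : UnitAddCircle) = (φ g).toAdd) ∧
      ∀ g, 0 ≤ θ g ∧ θ g < 1 := by
    choose θ h1 h2 using fun g ↦ AddCircle.eq_coe_Ico (p := (1 : ℝ)) (φ g).toAdd
    exact ⟨θ, h2, fun g ↦ h1 g⟩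
  have hθ0 : ∀ g, φ g = 1 ↔ θ g = 0 := fun g ↦ by
    rw [← AddCircle.coe_eq_zero_iff_of_mem_Ico (p := (1 : ℝ)) (hθmem g), hθ]; rfl
  -- Up to an integer, `θ` is additive.
  have hθadd : ∀ a b d : G, a * b * d = 1 → ∃ n : ℤ, θ a + θ b + θ d = n := by
    intro a b d h
    have : ((θ a + θ b + θ d : ℝ) : UnitAddCircle) = 0 := by
      rw [AddCircle.coe_add, AddCircle.coe_add, hθ, hθ, hθ, ← toAdd_mul, ← toAdd_mul, ← map_mul,
        ← map_mul, h, map_one, toAdd_one]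
    obtain ⟨n, hn⟩ := AddCircle.coe_eq_zero_iff _ |>.mp this
    exact ⟨n, by simpa using hn.symm⟩
  let r : G → ℝ := fun g ↦ if φ g = 1 then (if g ∈ P then 1 else if g⁻¹ ∈ P then -1 else 0)
    else 2 * θ g - 1
  have hr1 : r 1 = 0 := by simp [r, hP1]
  have hrinv : ∀ g, r g⁻¹ = -r g := by
    intro g
    by_cases hg : φ g = 1
    · by_cases hgP : g ∈ P
      · simp [r, hg, hgP, hPinv]
      · simp [r, hg, hgP]
        split_ifs <;> simp
    · obtain ⟨n, hn⟩ := hθadd g g⁻¹ 1 (by simp)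
      have h1 : θ 1 = 0 := (hθ0 1).mp (map_one φ)
      have h2 : θ g ≠ 0 := fun h ↦ hg ((hθ0 g).mpr h)
      have h3 := hθmem g
      have h4 := hθmem g⁻¹
      have h5 : 0 < θ g := lt_of_le_of_ne h3.1 h2.symm
      have h6 : (0 : ℝ) < n := by linarith
      have h7 : (n : ℝ) < 2 := by linarith
      have h8 : n = 1 := by
        have : 0 < n := by exact_mod_cast h6
        have : n < 2 := by exact_mod_cast h7
        lia
      subst h8
      simp only [r, map_inv, inv_eq_one, hg, if_false]
      push_cast at hn
      linarith
  -- The cyclic sum of `r` around a triangle with distinct vertices is `±1`.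
  have hrsum : ∀ a b d : G, a * b * d = 1 → a ≠ 1 → b ≠ 1 → d ≠ 1 →
      r a + r b + r d = 1 ∨ r a + r b + r d = -1 := by
    -- If all three are in the kernel, they do not all have the same sign.
    have hker : ∀ a b d : G, a * b * d = 1 → a ≠ 1 → b ≠ 1 → d ≠ 1 → φ a = 1 → φ b = 1 →
        φ d = 1 → r a + r b + r d = 1 ∨ r a + r b + r d = -1 := by
      intro a b d h ha hb hd hfa hfb hfd
      have h1 : ¬ (a ∈ P ∧ b ∈ P ∧ d ∈ P) := fun ⟨ha, hb, hd⟩ ↦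
        hP1 (h ▸ hPmul _ _ (hPmul _ _ ha hb) hd)
      have h2 : ¬ (a⁻¹ ∈ P ∧ b⁻¹ ∈ P ∧ d⁻¹ ∈ P) := fun ⟨ha, hb, hd⟩ ↦ by
        have h3 := hPmul _ _ (hPmul _ _ hd hb) ha
        have h4 : d⁻¹ * b⁻¹ * a⁻¹ = (a * b * d)⁻¹ := by group
        rw [h4, h, inv_one] at h3
        exact hP1 h3
      have ta := hPtot a hfa ha
      have tb := hPtot b hfb hb
      have td := hPtot d hfd hd
      by_cases a ∈ P <;> by_cases b ∈ P <;> by_cases d ∈ P <;> simp_all [r]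
    -- If just one is in the kernel, the values of `r` on the other two cancel.
    have hone : ∀ a b d : G, a * b * d = 1 → a ≠ 1 → φ a = 1 → φ b ≠ 1 →
        r a + r b + r d = 1 ∨ r a + r b + r d = -1 := by
      intro a b d h ha hfa hfb
      have h1 : φ d = (φ b)⁻¹ := by
        have := congrArg φ h
        rw [map_mul, map_mul, hfa, one_mul, map_one] at this
        exact (inv_eq_of_mul_eq_one_right this).symm
      have h2 : r b⁻¹ = r d := by
        have h3 : θ b⁻¹ = θ d := by
          have h4 : ((θ b⁻¹ : ℝ) : UnitAddCircle) = (θ d : ℝ) := by rw [hθ, hθ, h1, map_inv]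
          have h5 := hθmem b⁻¹
          have h6 := hθmem d
          exact (AddCircle.coe_eq_coe_iff_of_mem_Ico (p := (1 : ℝ)) (a := 0) (by simpa using h5)
            (by simpa using h6)).mp h4
        simp [r, h1, hfb, h3]
      have h3 := hrinv b
      have h4 : r a = 1 ∨ r a = -1 := by
        rcases hPtot a hfa ha with h | h
        · left; simp [r, hfa, h]
        · right
          have : a ∉ P := fun h' ↦ hPinv _ h' h
          simp [r, hfa, h, this]
      rcases h4 with h4 | h4
      · left; linarith
      · right; linarith
    intro a b d h ha hb hd
    have hbda : b * d * a = 1 := by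
      rw [mul_assoc] at h; exact mul_eq_one_comm.mp h
    have hdab : d * a * b = 1 := by
      rw [mul_assoc] at hbda; exact mul_eq_one_comm.mp hbda
    have hf : φ a * φ b * φ d = 1 := by rw [← map_mul, ← map_mul, h, map_one]
    by_cases hfa : φ a = 1
    · by_cases hfb : φ b = 1
      · exact hker a b d h ha hb hd hfa hfb (by simpa [hfa, hfb] using hf)
      · exact hone a b d h ha hfa hfb
    · by_cases hfb : φ b = 1
      · have hfd : φ d ≠ 1 := fun hfd ↦ hfa (by simpa [hfd, hfb] using hf)
        have := hone b d a hbda hb hfb hfd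
        rwa [show r a + r b + r d = r b + r d + r a by ring]
      · by_cases hfd : φ d = 1
        · have := hone d a b hdab hd hfd hfa
          rwa [show r a + r b + r d = r d + r a + r b by ring]
        · obtain ⟨n, hn⟩ := hθadd a b d h
          have key : ∀ g, φ g ≠ 1 → 0 < θ g ∧ θ g < 1 := fun g hg ↦
            ⟨lt_of_le_of_ne (hθmem g).1 (fun h ↦ hg ((hθ0 g).mpr h.symm)), (hθmem g).2⟩
          have ka := key a hfa
          have kb := key b hfb
          have kd := key d hfd
          have h6 : (0 : ℝ) < n := by linarith
          have h7 : (n : ℝ) < 3 := by linarith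
          have h8 : n = 1 ∨ n = 2 := by
            have : 0 < n := by exact_mod_cast h6
            have : n < 3 := by exact_mod_cast h7
            lia
          simp only [r, hfa, hfb, hfd, if_false]
          rcases h8 with rfl | rfl <;> push_cast at hn
          · right; linarith
          · left; linarith
  let R : G → G → G → ℝ := fun x y z ↦ r (x⁻¹ * y) + r (y⁻¹ * z) + r (z⁻¹ * x)
  have hsym : ∀ x y, r (x⁻¹ * y) = -r (y⁻¹ * x) := fun x y ↦ by
    rw [← hrinv, mul_inv_rev, inv_inv]
  have hR0 : ∀ x y z, (x = y ∨ x = z ∨ y = z) → R x y z = 0 := by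
    rintro x y z (rfl | rfl | rfl)
    · simp [R, hr1, hsym x z]
    · simp [R, hr1, hsym x y]
    · simp [R, hr1, hsym x y]
  have hR1 : ∀ x y z, ¬ (x = y ∨ x = z ∨ y = z) → R x y z = 1 ∨ R x y z = -1 := by
    intro x y z h
    push Not at h
    refine hrsum _ _ _ (by group) ?_ ?_ ?_
    · exact fun h' ↦ h.1 (inv_mul_eq_one.mp h')
    · exact fun h' ↦ h.2.2 (inv_mul_eq_one.mp h')
    · exact fun h' ↦ h.2.1 (inv_mul_eq_one.mp h').symm
  have hRint : ∀ x y z, ∃ n : ℤ, (n : ℝ) = R x y z := by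
    intro x y z
    by_cases h : x = y ∨ x = z ∨ y = z
    · exact ⟨0, by rw [hR0 x y z h]; simp⟩
    · rcases hR1 x y z h with h | h
      · exact ⟨1, by rw [h]; simp⟩
      · exact ⟨-1, by rw [h]; simp⟩
  choose c hc using hRint
  refine ⟨c, fun x y z ↦ ?_, fun x y z ↦ ⟨fun h ↦ ?_, fun h ↦ ?_⟩, fun x y z w ↦ ?_,
    fun h x y z ↦ ?_⟩
  · by_cases h : x = y ∨ x = z ∨ y = z
    · left
      have := hR0 x y z h
      rw [← hc] at this
      exact_mod_cast this
    · right
      have := hR1 x y z h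
      rw [← hc] at this
      exact_mod_cast this
  · by_contra hne
    have := hR1 x y z hne
    rw [← hc, h] at this
    norm_num at this
  · have := hR0 x y z h
    rw [← hc] at this
    exact_mod_cast this
  · have : (c y z w - c x z w + c x y w - c x y z : ℝ) = 0 := by
      simp only [hc, R]
      rw [hsym w x, hsym w y, hsym z x]
      ring
    exact_mod_cast this
  · have : (c (h * x) (h * y) (h * z) : ℝ) = c x y z := by
      simp only [hc, R]
      simp [mul_assoc]
    exact_mod_cast this

/-! ### The translation number -/

section TranslationNumber

open Filter Topology

variable {Γ : Type*} [Group Γ] {fl : Γ → ℤ}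

lemma pow_floor_bounds (hlo : ∀ x y, fl x + fl y ≤ fl (x * y))
    (hhi : ∀ x y, fl (x * y) ≤ fl x + fl y + 1) (h1 : fl 1 = 0) (x : Γ) (n : ℕ) :
    n * fl x ≤ fl (x ^ n) ∧ fl (x ^ n) ≤ n * (fl x + 1) := by
  induction n with
  | zero => simp [h1]
  | succ n ih =>
    have h2 := hlo (x ^ n) x
    have h3 := hhi (x ^ n) x
    rw [pow_succ]
    push_cast
    constructor <;> linarith [ih.1, ih.2]

/-- If `x * y ≤ y * x` in a bi-ordered group, then `x ^ n * y ^ n ≤ (x * y) ^ n ≤ y ^ n * x ^ n`,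
and a monotone function `fl` preserves these inequalities. The order is encoded as `a ≤ b ↔ 0 ≤ fl (a⁻¹ * b)`; it is
invariant on the right because `fl` is a class function. -/
lemma floor_mul_pow_between (hlo : ∀ x y, fl x + fl y ≤ fl (x * y)) (h1 : fl 1 = 0)
    (hconj : ∀ x y, fl (y * x * y⁻¹) = fl x) {x y : Γ} (hxy : 0 ≤ fl ((x * y)⁻¹ * (y * x)))
    (n : ℕ) : fl (x ^ n * y ^ n) ≤ fl ((x * y) ^ n) ∧ fl ((x * y) ^ n) ≤ fl (y ^ n * x ^ n) := by
  let le : Γ → Γ → Prop := fun a b ↦ 0 ≤ fl (a⁻¹ * b)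
  have refl : ∀ a, le a a := fun a ↦ by simp [le, h1]
  have trans : ∀ {a b d}, le a b → le b d → le a d := by
    intro a b d hab hbd
    have := hlo (a⁻¹ * b) (b⁻¹ * d)
    have e : a⁻¹ * b * (b⁻¹ * d) = a⁻¹ * d := by group
    rw [e] at this
    simp only [le] at *
    lia
  have left : ∀ d {a b}, le a b → le (d * a) (d * b) := by
    intro d a b hab
    simpa [le, mul_assoc] using hab
  have right : ∀ d {a b}, le a b → le (a * d) (b * d) := by
    intro d a b hab
    have := hconj (a⁻¹ * b) d⁻¹
    simp only [le] at *
    rw [← this] at hab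
    simpa [mul_assoc] using hab
  have mono : ∀ {a b}, le a b → fl a ≤ fl b := by
    intro a b hab
    have := hlo a (a⁻¹ * b)
    rw [mul_inv_cancel_left] at this
    simp only [le] at *
    lia
  have hxy' : le (x * y) (y * x) := hxy
  have hpow : ∀ n : ℕ, le ((x * y) ^ n) ((y * x) ^ n) := by
    intro n
    induction n with
    | zero => simpa using refl 1
    | succ n ih => rw [pow_succ, pow_succ]; exact trans (left _ hxy') (right _ ih)
  have hshift : ∀ (a b : Γ) (n : ℕ), a * (b * a) ^ n * b = (a * b) ^ (n + 1) := by
    intro a b n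
    induction n with
    | zero => simp
    | succ n ih =>
      rw [pow_succ, ← mul_assoc, ← mul_assoc, ih, pow_succ (a * b) (n + 1)]
      simp [mul_assoc]
  have key : ∀ n : ℕ, le (x ^ n * y ^ n) ((x * y) ^ n) ∧ le ((x * y) ^ n) (y ^ n * x ^ n) := by
    intro n
    induction n with
    | zero => simpa using refl 1
    | succ n ih =>
      constructor
      · have e : x ^ (n + 1) * y ^ (n + 1) = x * (x ^ n * y ^ n) * y := by
          rw [pow_succ', pow_succ]; simp [mul_assoc]
        rw [e, ← hshift x y]
        exact right _ (left _ (trans ih.1 (hpow n)))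
      · have e : y ^ (n + 1) * x ^ (n + 1) = y * (y ^ n * x ^ n) * x := by
          rw [pow_succ', pow_succ]; simp [mul_assoc]
        refine trans (hpow (n + 1)) ?_
        rw [e, ← hshift y x]
        exact right _ (left _ ih.2)
  exact ⟨mono (key n).1, mono (key n).2⟩

/-- The translation number `lim fl (x ^ n) / n` of a superadditive, conjugation-invariant function
of defect one is a homomorphism. Homogenising a quasimorphism does not give a homomorphism in
general; here it does because `fl` is monotone for the bi-invariant order it defines, so that
`floor_mul_pow_between` applies. -/
lemma exists_translationNumber (hlo : ∀ x y, fl x + fl y ≤ fl (x * y))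
    (hhi : ∀ x y, fl (x * y) ≤ fl x + fl y + 1) (h1 : fl 1 = 0)
    (hconj : ∀ x y, fl (y * x * y⁻¹) = fl x) :
    ∃ τ : Γ → ℝ, (∀ x y, τ (x * y) = τ x + τ y) ∧ ∀ x, (fl x : ℝ) ≤ τ x ∧ τ x ≤ fl x + 1 := by
  have hb : ∀ (x : Γ) (n : ℕ), n ≠ 0 →
      (fl x : ℝ) ≤ fl (x ^ n) / n ∧ (fl (x ^ n) : ℝ) / n ≤ fl x + 1 := by
    intro x n hn
    have hn' : (0 : ℝ) < n := by exact_mod_cast Nat.pos_of_ne_zero hn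
    obtain ⟨h2, h3⟩ := pow_floor_bounds hlo hhi h1 x n
    rw [le_div_iff₀ hn', div_le_iff₀ hn', mul_comm, mul_comm _ (n : ℝ)]
    exact ⟨by exact_mod_cast h2, by exact_mod_cast h3⟩
  have hlim : ∀ x : Γ, ∃ t : ℝ, Tendsto (fun n : ℕ ↦ (fl (x ^ n) : ℝ) / n) atTop (𝓝 t) := by
    intro x
    have hsub : Subadditive fun n ↦ -(fl (x ^ n) : ℝ) := by
      intro m n
      have := hlo (x ^ m) (x ^ n)
      rw [← pow_add] at this
      have : (fl (x ^ m) : ℝ) + fl (x ^ n) ≤ fl (x ^ (m + n)) := by exact_mod_cast this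
      linarith
    have hbdd : BddBelow (Set.range fun n : ℕ ↦ -(fl (x ^ n) : ℝ) / n) := by
      refine ⟨min 0 (-(fl x + 1)), ?_⟩
      rintro _ ⟨n, rfl⟩
      rcases eq_or_ne n 0 with rfl | hn
      · simp
      · refine min_le_of_right_le ?_
        have := (hb x n hn).2
        simp only [neg_div]
        linarith
    have := (hsub.tendsto_lim hbdd).neg
    exact ⟨_, by simpa [neg_div] using this⟩
  choose τ hτ using hlim
  have hadd : ∀ x y, 0 ≤ fl ((x * y)⁻¹ * (y * x)) → τ (x * y) = τ x + τ y := by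
    intro x y hxy
    have hdiff : Tendsto (fun n : ℕ ↦ (fl ((x * y) ^ n) : ℝ) / n - (fl (x ^ n) / n + fl (y ^ n) / n))
        atTop (𝓝 0) := by
      refine squeeze_zero (g := fun n : ℕ ↦ 1 / (n : ℝ)) (fun n ↦ ?_) (fun n ↦ ?_)
        tendsto_one_div_atTop_nhds_zero_nat
      all_goals
        obtain ⟨h2, h3⟩ := floor_mul_pow_between hlo h1 hconj hxy n
        rw [← add_div, ← sub_div]
      · refine div_nonneg ?_ n.cast_nonneg
        have := hlo (x ^ n) (y ^ n)
        have : fl (x ^ n) + fl (y ^ n) ≤ fl ((x * y) ^ n) := by lia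
        have : (fl (x ^ n) : ℝ) + fl (y ^ n) ≤ fl ((x * y) ^ n) := by exact_mod_cast this
        linarith
      · refine div_le_div_of_nonneg_right ?_ n.cast_nonneg
        have := hhi (y ^ n) (x ^ n)
        have : fl ((x * y) ^ n) ≤ fl (y ^ n) + fl (x ^ n) + 1 := by lia
        have : (fl ((x * y) ^ n) : ℝ) ≤ fl (y ^ n) + fl (x ^ n) + 1 := by exact_mod_cast this
        linarith
    have := tendsto_nhds_unique hdiff ((hτ (x * y)).sub ((hτ x).add (hτ y)))
    linarith
  refine ⟨τ, fun x y ↦ ?_, fun x ↦ ⟨?_, ?_⟩⟩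
  · have hconjτ : τ (x * y) = τ (y * x) := by
      refine tendsto_nhds_unique (hτ (x * y)) ((hτ (y * x)).congr fun n ↦ ?_)
      have : x * (y * x) ^ n * x⁻¹ = (x * y) ^ n := by
        rw [← conj_pow]; simp [mul_assoc]
      rw [← this, hconj]
    rcases le_or_gt 0 (fl ((x * y)⁻¹ * (y * x))) with h | h
    · exact hadd x y h
    · have h2 := hhi ((x * y)⁻¹ * (y * x)) ((y * x)⁻¹ * (x * y))
      have e : (x * y)⁻¹ * (y * x) * ((y * x)⁻¹ * (x * y)) = 1 := by group
      rw [e, h1] at h2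
      rw [hconjτ, hadd y x (by lia), add_comm]
  · exact ge_of_tendsto (hτ x) ((eventually_ne_atTop 0).mono fun n hn ↦ (hb x n hn).1)
  · exact le_of_tendsto (hτ x) ((eventually_ne_atTop 0).mono fun n hn ↦ (hb x n hn).2)

end TranslationNumber

/-! ### The central extension of a bi-invariantly circularly-ordered group -/

namespace IsCircularOrdering

variable {G : Type*} [Group G] {c : G → G → G → ℤ}

open Classical in
/-- The inhomogeneous Euler cocycle of `c`: it is `1` if multiplication by `g` carries the arc
from `1` to `h` across `1`, and `0` otherwise. -/
noncomputable def euler (c : G → G → G → ℤ) (g h : G) : ℤ :=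
  if c 1 g (g * h) = -1 ∨ (g * h = 1 ∧ g ≠ 1) then 1 else 0

lemma euler_nonneg (c : G → G → G → ℤ) (g h : G) : 0 ≤ euler c g h := by
  unfold euler; split_ifs <;> simp

lemma euler_le_one (c : G → G → G → ℤ) (g h : G) : euler c g h ≤ 1 := by
  unfold euler; split_ifs <;> simp

open Classical in
/-- Up to the coboundary of a delta function, `euler c` is the class `(1 - c) / 2`. -/
lemma two_mul_euler (hc : IsCircularOrdering c) (g h : G) :
    2 * euler c g h = 1 - c 1 g (g * h) - (if g = 1 then 1 else 0) - (if h = 1 then 1 else 0)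
      + (if g * h = 1 then 1 else 0) := by
  have hv := hc.values 1 g (g * h)
  have hz := hc.eq_zero_iff 1 g (g * h)
  rw [left_eq_mul, eq_comm (a := 1), eq_comm (a := 1)] at hz
  unfold euler
  by_cases hg : g = 1
  · subst hg
    simp only [one_mul, true_or, iff_true] at hz
    simp [hz]
  · by_cases hh : h = 1
    · subst hh
      simp only [mul_one, or_true, iff_true] at hz
      simp [hz, hg]
    · by_cases hgh : g * h = 1
      · simp only [hgh, hg, hh, true_or, or_true, iff_true] at hz
        simp [hgh, hz, hg, hh]
      · simp only [hgh, hg, hh, or_false, iff_false] at hz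
        rcases hv with hv | hv | hv
        · exact absurd hv hz
        · simp [hgh, hv, hg, hh]
        · simp [hgh, hv, hg, hh]

lemma euler_cocycle (hc : IsCircularOrdering c) (g h k : G) :
    euler c g h + euler c (g * h) k = euler c h k + euler c g (h * k) := by
  have h1 := hc.two_mul_euler g h
  have h2 := hc.two_mul_euler (g * h) k
  have h3 := hc.two_mul_euler h k
  have h4 := hc.two_mul_euler g (h * k)
  have h5 := hc.cocycle 1 g (g * h) (g * (h * k))
  have h6 := hc.left_invariant g 1 h (h * k)
  rw [mul_one] at h6
  rw [← mul_assoc] at *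
  lia

@[simp] lemma euler_one_left (hc : IsCircularOrdering c) (g : G) : euler c 1 g = 0 := by
  have := (hc.eq_zero_iff 1 1 g).mpr (by simp)
  simp [euler, this]

@[simp] lemma euler_one_right (hc : IsCircularOrdering c) (g : G) : euler c g 1 = 0 := by
  have := (hc.eq_zero_iff 1 g g).mpr (by simp)
  simp [euler, this]

lemma euler_inv_right (c : G → G → G → ℤ) {g : G} (hg : g ≠ 1) : euler c g g⁻¹ = 1 := by
  simp [euler, hg]

end IsCircularOrdering

namespace IsBiInvariantCircularOrdering

open IsCircularOrdering

variable {G : Type*} [Group G] {c : G → G → G → ℤ}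

lemma conj_invariant (hc : IsBiInvariantCircularOrdering c) (h x y z : G) :
    c (h * x * h⁻¹) (h * y * h⁻¹) (h * z * h⁻¹) = c x y z := by
  rw [hc.right_invariant, hc.left_invariant]

lemma cutLT_conj (hc : IsBiInvariantCircularOrdering c) (h x y : G) :
    cutLT c (h * x * h⁻¹) (h * y * h⁻¹) ↔ cutLT c x y := by
  have := hc.conj_invariant h 1 x y
  rw [mul_one, mul_inv_cancel] at this
  simp [cutLT, this]

/-- Multiplication by `g` on the left carries `h` past `1` if and only if multiplication by `h` on
the right carries `g` past `1`. Otherwise `g * h` would lie between `g` and `h`, and `g`, `h`, `g⁻¹`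
and `h⁻¹` would form a cycle in the linear order of the circle cut at `1`. -/
lemma apply_one_mul_comm (hc : IsBiInvariantCircularOrdering c) (g h : G) :
    c 1 g (g * h) = c 1 h (g * h) := by
  have hc' := hc.toIsCircularOrdering
  -- The triangles `(1, g⁻¹, h⁻¹)` and `(g * h, h, g)` are translates of each other.
  have t1 : c (g * h) h g = c 1 g⁻¹ h⁻¹ := by
    rw [← hc.right_invariant h 1, ← hc.left_invariant g (1 * h)]; simp
  have t2 : c 1 g (g * h) = c 1 h g⁻¹ := by
    rw [hc'.rotate g⁻¹ 1 h, ← hc.left_invariant g g⁻¹]; simp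
  have t3 : c 1 h (g * h) = c 1 g h⁻¹ := by
    rw [hc'.rotate h⁻¹ 1 g, ← hc.right_invariant h h⁻¹]; simp
  have t4 := hc.cocycle 1 g h (g * h)
  have t5 := hc'.rotate (g * h) g h
  have t6 := hc'.swap (g * h) g h
  have hlt := hc'.isStrictTotalOrder_cutLT
  have hcyc : ∀ a b d e : G, c 1 a b = 1 → c 1 b d = 1 → c 1 d e = 1 → c 1 e a ≠ 1 := by
    intro a b d e h1 h2 h3 h4
    have h5 : cutLT c a e :=
      trans_of (cutLT c) (trans_of (cutLT c) (Or.inl h1) (Or.inl h2)) (Or.inl h3)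
    exact irrefl_of (cutLT c) a (trans_of (cutLT c) h5 (Or.inl h4))
  have hzero : c 1 g (g * h) = 0 ↔ c 1 h (g * h) = 0 := by
    rw [hc.eq_zero_iff, hc.eq_zero_iff, left_eq_mul, right_eq_mul, eq_comm (a := 1) (b := g),
      eq_comm (a := 1) (b := h)]
    tauto
  rcases hc.values 1 g (g * h) with v1 | v1 | v1
  · rw [v1, hzero.mp v1]
  all_goals
    by_contra hne
    have v2 := hc.values 1 h (g * h)
    have v3 := hc.values 1 g⁻¹ h⁻¹
    have v4 := hc.values 1 g h
  · have e1 : c 1 h (g * h) = -1 := by lia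
    have e2 : c 1 g h = 1 := by lia
    have e3 : c 1 g⁻¹ h⁻¹ = 1 := by lia
    exact hcyc g h g⁻¹ h⁻¹ e2 (t2 ▸ v1) e3 (by rw [hc'.swap, ← t3]; lia)
  · have e1 : c 1 h (g * h) = 1 := by lia
    have e2 : c 1 g h = -1 := by lia
    have e3 : c 1 g⁻¹ h⁻¹ = -1 := by lia
    exact hcyc h g h⁻¹ g⁻¹ (by rw [hc'.swap]; lia) (t3 ▸ e1) (by rw [hc'.swap]; lia)
      (by rw [hc'.swap, ← t2]; lia)

/-- The identity that makes the number of turns in the central extension a class function. -/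
lemma euler_conj (hc : IsBiInvariantCircularOrdering c) (g h : G) :
    euler c h g + euler c (h * g) h⁻¹ = euler c h h⁻¹ := by
  have hc' := hc.toIsCircularOrdering
  have h1 := hc'.two_mul_euler h g
  have h2 := hc'.two_mul_euler (h * g) h⁻¹
  have h3 := hc'.two_mul_euler h h⁻¹
  have h4 := hc.apply_one_mul_comm h g
  have h5 : c 1 (h * g) (h * g * h⁻¹) = c 1 (g * h) g := by
    have := hc.conj_invariant h 1 (g * h) g
    rw [← this]; simp [mul_assoc]
  have h6 := hc'.swap 1 g (g * h)
  have h7 : c 1 g (h * g) = c 1 g (g * h) := by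
    have := hc.conj_invariant g 1 g (h * g)
    rw [← this]; simp [mul_assoc]
  have h8 : c 1 h 1 = 0 := (hc.eq_zero_iff _ _ _).mpr (by simp)
  have h9 : h * g * h⁻¹ = 1 ↔ g = 1 := conj_eq_one_iff
  simp only [inv_eq_one, h9, mul_inv_cancel, if_true, h8] at h1 h2 h3
  rw [h5] at h2
  lia

/-- The central extension of `G` by `ℤ` with cocycle `euler c`. The element `⟨m, g⟩` is the lift to
the line of the point `g` of the circle, in the `m`-th turn. -/
@[ext] structure Lift (hc : IsBiInvariantCircularOrdering c) where
  /-- The number of complete turns. -/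
  turns : ℤ
  /-- The point on the circle. -/
  point : G

namespace Lift

variable {hc : IsBiInvariantCircularOrdering c}

noncomputable instance : Mul hc.Lift :=
  ⟨fun x y ↦ ⟨x.turns + y.turns + euler c x.point y.point, x.point * y.point⟩⟩

instance : One hc.Lift := ⟨⟨0, 1⟩⟩

noncomputable instance : Inv hc.Lift :=
  ⟨fun x ↦ ⟨-x.turns - euler c x.point⁻¹ x.point, x.point⁻¹⟩⟩

@[simp] lemma mul_turns (x y : hc.Lift) :
    (x * y).turns = x.turns + y.turns + euler c x.point y.point := rfl
@[simp] lemma mul_point (x y : hc.Lift) : (x * y).point = x.point * y.point := rfl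
@[simp] lemma one_turns : (1 : hc.Lift).turns = 0 := rfl
@[simp] lemma one_point : (1 : hc.Lift).point = 1 := rfl
@[simp] lemma inv_turns (x : hc.Lift) :
    x⁻¹.turns = -x.turns - euler c x.point⁻¹ x.point := rfl
@[simp] lemma inv_point (x : hc.Lift) : x⁻¹.point = x.point⁻¹ := rfl

noncomputable instance : Group hc.Lift :=
  Group.ofLeftAxioms
    (fun x y z ↦ by
      have := hc.toIsCircularOrdering.euler_cocycle x.point y.point z.point
      ext
      · simp only [mul_turns, mul_point]; lia
      · simp [mul_assoc])
    (fun x ↦ by ext <;> simp [hc.toIsCircularOrdering])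
    (fun x ↦ by
      ext
      · simp only [mul_turns, inv_turns, inv_point, one_turns]; lia
      · simp)

/-- The number of turns is invariant under conjugation. -/
lemma turns_conj (x y : hc.Lift) : (y * x * y⁻¹).turns = x.turns := by
  have h1 := hc.euler_conj x.point y.point
  have h2 : euler c y.point⁻¹ y.point = euler c y.point y.point⁻¹ := by
    by_cases h : y.point = 1
    · simp [h]
    · rw [euler_inv_right c h]
      simpa using euler_inv_right c (inv_ne_one.mpr h)
  simp only [mul_turns, mul_point, inv_turns, inv_point]
  lia

lemma eq_one_of_turns_nonneg {x : hc.Lift} (h : 0 ≤ x.turns) (h' : 0 ≤ x⁻¹.turns) : x = 1 := by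
  rw [inv_turns] at h'
  by_cases hx : x.point = 1
  · ext
    · have := euler_nonneg c x.point⁻¹ x.point
      rw [one_turns]; lia
    · exact hx
  · have := euler_inv_right c (inv_ne_one.mpr hx)
    rw [inv_inv] at this
    lia

/-- The lift is torsion-free, being bi-ordered with nonnegative elements those with `0 ≤ turns`. -/
lemma eq_one_of_pow_eq_one {x : hc.Lift} {n : ℕ} (hn : n ≠ 0) (hx : x ^ n = 1) : x = 1 := by
  have key : ∀ y : hc.Lift, y ^ n = 1 → 0 ≤ y.turns → y = 1 := by
    intro y hy hy0
    have hpow : ∀ m : ℕ, 0 ≤ (y ^ m).turns := by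
      intro m
      induction m with
      | zero => simp
      | succ m ih =>
        rw [pow_succ, mul_turns]
        have := euler_nonneg c (y ^ m).point y.point
        lia
    obtain ⟨m, rfl⟩ := Nat.exists_eq_succ_of_ne_zero hn
    refine eq_one_of_turns_nonneg hy0 ?_
    rw [inv_eq_of_mul_eq_one_left (a := y ^ m) (by rw [← pow_succ]; exact hy)]
    exact hpow m
  by_cases h0 : 0 ≤ x.turns
  · exact key x hx h0
  · refine inv_eq_one.mp (key x⁻¹ (by rw [inv_pow, hx, inv_one]) ?_)
    have := euler_le_one c x.point⁻¹ x.point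
    rw [inv_turns]; lia

end Lift

/-- The rotation number of a bi-invariant circular ordering is a homomorphism to `ℝ/ℤ`, and it is
injective on elements of finite order. -/
lemma exists_rotationNumber (hc : IsBiInvariantCircularOrdering c) :
    ∃ ρ : G →* Multiplicative UnitAddCircle, ∀ g, IsOfFinOrder g → ρ g = 1 → g = 1 := by
  have hc' := hc.toIsCircularOrdering
  obtain ⟨τ, hτ, hτb⟩ := exists_translationNumber (fl := fun x : hc.Lift ↦ x.turns)
    (fun x y ↦ by have := euler_nonneg c x.point y.point; simp only [Lift.mul_turns]; lia)
    (fun x y ↦ by have := euler_le_one c x.point y.point; simp only [Lift.mul_turns]; lia)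
    rfl Lift.turns_conj
  have hτ1 : τ 1 = 0 := by simpa using hτ 1 1
  have hτpow : ∀ (x : hc.Lift) (n : ℕ), τ (x ^ n) = n * τ x := by
    intro x n
    induction n with
    | zero => simpa using hτ1
    | succ n ih => rw [pow_succ, hτ, ih]; push_cast; ring
  -- The central elements `⟨m, 1⟩` are translations by `m`.
  have hcentral : ∀ m : ℤ, τ ⟨m, 1⟩ = m := by
    intro m
    have hpow : ∀ n : ℕ, ((⟨m, 1⟩ : hc.Lift) ^ n) = ⟨n * m, 1⟩ := by
      intro n
      induction n with
      | zero => ext <;> simp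
      | succ n ih =>
        rw [pow_succ, ih]
        ext
        · simp [hc']; ring
        · simp
    have hb : ∀ n : ℕ, (n : ℝ) * |τ ⟨m, 1⟩ - m| ≤ 1 := by
      intro n
      have h1 := hτb ((⟨m, 1⟩ : hc.Lift) ^ n)
      rw [hτpow, hpow] at h1
      push_cast at h1
      rw [← abs_of_nonneg (n.cast_nonneg (α := ℝ)), ← abs_mul, abs_le]
      constructor <;> linarith [h1.1, h1.2]
    by_contra hne
    have hpos : 0 < |τ ⟨m, 1⟩ - m| := abs_pos.mpr (sub_ne_zero.mpr hne)
    obtain ⟨n, hn⟩ := exists_nat_gt (1 / |τ ⟨m, 1⟩ - m|)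
    rw [div_lt_iff₀ hpos] at hn
    exact absurd (hb n) (not_le.mpr hn)
  have hsplit : ∀ (m k : ℤ) (g : G), τ ⟨m + k, g⟩ = m + τ ⟨k, g⟩ := by
    intro m k g
    rw [← hcentral m, ← hτ]; congr 1; ext <;> simp [hc']
  let ρ : G →* Multiplicative UnitAddCircle := MonoidHom.mk'
    (fun g ↦ .ofAdd ((τ ⟨0, g⟩ : ℝ) : UnitAddCircle)) (fun g h ↦ by
      have h1 : (⟨0, g⟩ * ⟨0, h⟩ : hc.Lift) = ⟨euler c g h + 0, g * h⟩ := by ext <;> simp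
      have h2 := hτ ⟨0, g⟩ ⟨0, h⟩
      rw [h1, hsplit] at h2
      rw [← ofAdd_add, ← AddCircle.coe_add, ← h2, AddCircle.coe_add]
      have : (((euler c g h : ℤ) : ℝ) : UnitAddCircle) = 0 :=
        (AddCircle.coe_eq_zero_iff _).mpr ⟨euler c g h, by simp⟩
      rw [this, zero_add])
  refine ⟨ρ, fun g hg hρ ↦ ?_⟩
  obtain ⟨n, hn, hgn⟩ := isOfFinOrder_iff_pow_eq_one.mp hg
  obtain ⟨k, hk⟩ := (AddCircle.coe_eq_zero_iff _).mp (Multiplicative.ofAdd.injective hρ :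
    ((τ ⟨0, g⟩ : ℝ) : UnitAddCircle) = 0)
  -- The lift of `g` with translation number zero has finite order, hence is trivial.
  let x : hc.Lift := ⟨-k, g⟩
  have hx0 : τ x = 0 := by
    have := hsplit (-k) 0 g
    rw [add_zero, ← hk] at this
    simpa [x] using this
  have hpt : ∀ m : ℕ, (x ^ m).point = g ^ m := by
    intro m
    induction m with
    | zero => simp
    | succ m ih => rw [pow_succ, pow_succ, Lift.mul_point, ih]
  have hxn : x ^ n = 1 := by
    have h1 : x ^ n = ⟨(x ^ n).turns, 1⟩ := by
      ext
      · rfl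
      · rw [hpt, hgn]
    have h2 := hτpow x n
    rw [h1, hcentral, hx0, mul_zero] at h2
    rw [h1]
    ext
    · exact_mod_cast h2
    · rfl
  exact congrArg Lift.point (Lift.eq_one_of_pow_eq_one hn.ne' hxn)

/-- Conjugation preserves the linear order of the circle cut at `1`, and its kernel is the centre;
so `G` acts on a totally ordered set with abelian kernel. -/
lemma exists_hom_leftOrderable (hc : IsBiInvariantCircularOrdering c) :
    ∃ f : G →* (cutLT c ≃r cutLT c), ∀ g, f g = 1 → ∀ h, g * h = h * g := by
  refine ⟨{ toFun := fun g ↦ ⟨(MulAut.conj g).toEquiv, hc.cutLT_conj g _ _⟩,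
            map_one' := by ext; simp, map_mul' := fun g h ↦ by ext; simp }, fun g hg h ↦ ?_⟩
  have : g * h * g⁻¹ = h := by simpa using DFunLike.congr_fun hg h
  exact mul_inv_eq_iff_eq_mul.mp this

end IsBiInvariantCircularOrdering

/-! ### Torsion and circular orderability of products -/

/-- The primes that are orders of elements of `G`. -/
def torsionPrimes (G : Type*) [Group G] : Set ℕ :=
  {p | p.Prime ∧ ∃ g : G, orderOf g = p}

lemma mem_torsionPrimes_of_dvd_orderOf {G : Type*} [Group G] {p : ℕ} (hp : p.Prime) {g : G}
    (hg : IsOfFinOrder g) (h : p ∣ orderOf g) : p ∈ torsionPrimes G :=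
  ⟨hp, g ^ (orderOf g / p), orderOf_pow_orderOf_div hg.orderOf_pos.ne' h⟩

lemma torsionPrimes_eq_empty_iff {G : Type*} [Group G] :
    torsionPrimes G = ∅ ↔ ∀ g : G, IsOfFinOrder g → g = 1 := by
  constructor
  · intro h g hg
    by_contra hne
    obtain ⟨p, hp, hpg⟩ := Nat.exists_prime_and_dvd (mt orderOf_eq_one_iff.mp hne)
    exact h.subset (mem_torsionPrimes_of_dvd_orderOf hp hg hpg)
  · intro h
    rw [Set.eq_empty_iff_forall_notMem]
    rintro p ⟨hp, g, hg⟩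
    have hfin : IsOfFinOrder g := orderOf_pos_iff.mp (hg ▸ hp.pos)
    rw [h g hfin, orderOf_one] at hg
    exact hp.ne_one hg.symm

/-- A torsion-free group with abelian kernel over a left-orderable group is left-orderable. -/
lemma LeftOrderable.of_abelian_ker {G Q : Type*} [Group G] [Group Q] (f : G →* Q)
    (hQ : LeftOrderable Q) (hf : ∀ a b, f a = 1 → f b = 1 → a * b = b * a)
    (htf : ∀ g : G, IsOfFinOrder g → g = 1) : LeftOrderable G :=
  .of_ker f hQ <| leftOrderable_of_commute (fun a b ↦ Subtype.ext (hf a b a.2 b.2))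
    fun a ha ↦ Subtype.ext (htf a ((Subgroup.subtype _).isOfFinOrder ha))

/-- The rotation numbers of the two factors add up to a homomorphism to `ℝ/ℤ`. If the factors have
no torsion primes in common its kernel is torsion-free, hence left-orderable. -/
lemma circularlyOrderable_prod_of_disjoint {G H : Type*} [Group G] [Group H]
    (hG : BiInvariantlyCircularlyOrderable G) (hH : BiInvariantlyCircularlyOrderable H)
    (hdisj : torsionPrimes G ∩ torsionPrimes H = ∅) : CircularlyOrderable (G × H) := by
  obtain ⟨c, hc⟩ := hG
  obtain ⟨d, hd⟩ := hH
  obtain ⟨ρ, hρ⟩ := hc.exists_rotationNumber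
  obtain ⟨σ, hσ⟩ := hd.exists_rotationNumber
  obtain ⟨α, hα⟩ := hc.exists_hom_leftOrderable
  obtain ⟨β, hβ⟩ := hd.exists_hom_leftOrderable
  have := hc.isStrictTotalOrder_cutLT
  have := hd.isStrictTotalOrder_cutLT
  refine circularlyOrderable_of_leftOrderable_ker (ρ.coprod σ) ?_
  refine .of_abelian_ker ((α.prodMap β).comp (Subgroup.subtype _))
    ((leftOrderable_relIso _).prod (leftOrderable_relIso _)) ?_ ?_
  · rintro ⟨⟨a, b⟩, _⟩ ⟨⟨a', b'⟩, _⟩ h _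
    have h1 : α a = 1 := congrArg Prod.fst h
    have h2 : β b = 1 := congrArg Prod.snd h
    exact Subtype.ext (Prod.ext (hα a h1 a') (hβ b h2 b'))
  · rintro ⟨⟨a, b⟩, hab⟩ hfin
    have hfin : IsOfFinOrder (a, b) := (Subgroup.subtype _).isOfFinOrder hfin
    have ha : IsOfFinOrder a := hfin.fst
    have hb : IsOfFinOrder b := hfin.snd
    have hab : ρ a * σ b = 1 := by simpa using hab
    -- `a` and `b` have the same order, as their rotation numbers are inverse to each other.
    have horda : orderOf (ρ a) = orderOf a := by
      refine dvd_antisymm (orderOf_map_dvd ρ a) (orderOf_dvd_of_pow_eq_one ?_)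
      exact hρ _ ha.pow (by rw [map_pow, pow_orderOf_eq_one])
    have hordb : orderOf (σ b) = orderOf b := by
      refine dvd_antisymm (orderOf_map_dvd σ b) (orderOf_dvd_of_pow_eq_one ?_)
      exact hσ _ hb.pow (by rw [map_pow, pow_orderOf_eq_one])
    have hord : orderOf a = orderOf b := by
      rw [← horda, ← hordb, eq_inv_of_mul_eq_one_left hab, orderOf_inv]
    have ha1 : orderOf a = 1 := by
      by_contra hne
      obtain ⟨p, hp, hpa⟩ := Nat.exists_prime_and_dvd hne
      exact hdisj.subset ⟨mem_torsionPrimes_of_dvd_orderOf hp ha hpa,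
        mem_torsionPrimes_of_dvd_orderOf hp hb (hord ▸ hpa)⟩
    exact Subtype.ext
      (Prod.ext (orderOf_eq_one_iff.mp ha1) (orderOf_eq_one_iff.mp (hord ▸ ha1)))

lemma circularlyOrderable_prod_iff {G H : Type*} [Group G] [Group H]
    (hG : BiInvariantlyCircularlyOrderable G) (hH : BiInvariantlyCircularlyOrderable H) :
    CircularlyOrderable (G × H) ↔ torsionPrimes G ∩ torsionPrimes H = ∅ := by
  refine ⟨fun h ↦ ?_, circularlyOrderable_prod_of_disjoint hG hH⟩
  rw [Set.eq_empty_iff_forall_notMem]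
  rintro p ⟨⟨hp, x, hx⟩, -, y, hy⟩
  exact h.orderOf_ne_of_prod hp hx hy

/-! ### The obstruction spectrum -/

lemma biInvariantlyCircularlyOrderable_zmod (n : ℕ) [NeZero n] :
    BiInvariantlyCircularlyOrderable (Multiplicative (ZMod n)) := by
  let φ : Multiplicative (ZMod n) →* Multiplicative UnitAddCircle :=
    AddMonoidHom.toMultiplicative ZMod.toAddCircle
  have hφ : ∀ a, φ a = 1 → a = 1 := fun a ha ↦ ZMod.toAddCircle_eq_zero.mp ha
  obtain ⟨c, hc⟩ := circularlyOrderable_of_leftOrderable_ker φ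
    (leftOrderable_of_commute (fun a b ↦ mul_comm a b) fun a _ ↦ Subtype.ext (hφ a a.2))
  refine ⟨c, hc, fun h x y z ↦ ?_⟩
  rw [mul_comm x, mul_comm y, mul_comm z, hc.left_invariant]

lemma mem_torsionPrimes_zmod_iff {n : ℕ} [NeZero n] {p : ℕ} :
    p ∈ torsionPrimes (Multiplicative (ZMod n)) ↔ p.Prime ∧ p ∣ n := by
  have hcard : Nat.card (Multiplicative (ZMod n)) = n := by simp
  constructor
  · rintro ⟨hp, g, rfl⟩
    exact ⟨hp, by simpa [hcard] using orderOf_dvd_natCard g⟩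
  · rintro ⟨hp, hpn⟩
    have := Fact.mk hp
    exact ⟨hp, exists_prime_orderOf_dvd_card' p (by rwa [hcard])⟩

lemma mem_obstructionSpectrum_iff {G : Type*} [Group G]
    (hG : BiInvariantlyCircularlyOrderable G) {n : ℕ} :
    n ∈ obstructionSpectrum G ↔ 2 ≤ n ∧ ∃ p ∈ torsionPrimes G, p ∣ n := by
  refine and_congr_right fun hn ↦ ?_
  have : NeZero n := ⟨by lia⟩
  rw [circularlyOrderable_prod_iff hG (biInvariantlyCircularlyOrderable_zmod n), ← ne_eq,
    ← Set.nonempty_iff_ne_empty]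
  refine exists_congr fun p ↦ ?_
  rw [Set.mem_inter_iff, mem_torsionPrimes_zmod_iff]
  exact ⟨fun h ↦ ⟨h.1, h.2.2⟩, fun h ↦ ⟨h.1, h.1.1, h.2⟩⟩

lemma minObstructionSpectrum_eq_torsionPrimes {G : Type*} [Group G]
    (hG : BiInvariantlyCircularlyOrderable G) :
    minObstructionSpectrum G = torsionPrimes G := by
  have hsub : ∀ p ∈ torsionPrimes G, p ∈ obstructionSpectrum G := fun p hp ↦
    (mem_obstructionSpectrum_iff hG).mpr ⟨hp.1.two_le, p, hp, dvd_rfl⟩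
  ext n
  constructor
  · rintro ⟨hn, hmin⟩
    obtain ⟨-, p, hp, hpn⟩ := (mem_obstructionSpectrum_iff hG).mp hn
    exact hmin p (hsub p hp) hpn ▸ hp
  · intro hn
    refine ⟨hsub n hn, fun m hm hmn ↦ ?_⟩
    have : 2 ≤ m := hm.1
    exact ((Nat.dvd_prime hn.1).mp hmn).resolve_left (by lia)

lemma leftOrderable_iff_torsionPrimes_eq_empty {G : Type*} [Group G]
    (hG : BiInvariantlyCircularlyOrderable G) : LeftOrderable G ↔ torsionPrimes G = ∅ := by
  rw [torsionPrimes_eq_empty_iff]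
  refine ⟨fun h g hg ↦ h.eq_one_of_isOfFinOrder hg, fun h ↦ ?_⟩
  obtain ⟨c, hc⟩ := hG
  obtain ⟨α, hα⟩ := hc.exists_hom_leftOrderable
  have := hc.isStrictTotalOrder_cutLT
  exact .of_abelian_ker α (leftOrderable_relIso _) (fun a b ha _ ↦ hα a ha b) h

theorem mainTheorem11 :
    (∀ (G : Type*) (H : Type*) [Group G] [Group H],
      BiInvariantlyCircularlyOrderable G → BiInvariantlyCircularlyOrderable H →
        (CircularlyOrderable (G × H) ↔
          minObstructionSpectrum G ∩ minObstructionSpectrum H = ∅)) ∧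
    (∀ (G : Type*) [Group G], BiInvariantlyCircularlyOrderable G →
        (CircularlyOrderable (G × G) ↔ LeftOrderable G)) := by
  refine ⟨fun G H _ _ hG hH ↦ ?_, fun G _ hG ↦ ?_⟩
  · rw [circularlyOrderable_prod_iff hG hH, minObstructionSpectrum_eq_torsionPrimes hG,
      minObstructionSpectrum_eq_torsionPrimes hH]
  · rw [circularlyOrderable_prod_iff hG hG, Set.inter_self,
      leftOrderable_iff_torsionPrimes_eq_empty hG]
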